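/- Let $p$ be a prime and $P$ a finite $p$-group. Write maps on the right and $x^g = g^{-1}xg$. A fusion system $\mathcal F$ on $P$ consists of a set $\operatorname{Hom}_{\mathcal F}(Q,R)$ of injective homomorphisms $Q\to R$ for all $Q,R\le P$, closed under composition, such that: for each $g\in P$ with $Q^g\le R$ the conjugation map $x\mapsto x^g$ lies in $\operatorname{Hom}_{\mathcal F}(Q,R)$; for each $\phi\in\operatorname{Hom}_{\mathcal F}(Q,R)$ the induced isomorphism $Q\to Q\phi$ lies in $\operatorname{Hom}_{\mathcal F}(Q,Q\phi)$; and inverses of isomorphisms in $\mathcal F$ lie in $\mathcal F$. A subgroup $Q$ is fully normalized if $|N_P(Q)|\ge|N_P(R)|$ whenever there is an isomorphism $Q\to R$ in $\mathcal F$. The fusion system $\mathcal F$ is saturated if $\operatorname{Aut}_P(P)$, the group of inner automorphisms of $P$, is a Sylow $p$-subgroup of $\operatorname{Aut}_{\mathcal F}(P)=\operatorname{Hom}_{\mathcal F}(P,P)$, and every morphism $\phi:Q\to P$ in $\mathcal F$ with $Q\phi$ fully normalized extends to a morphism $N_\phi\to P$ in $\mathcal F$, where $N_\phi$ is the group of all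 $x\in N_P(Q)$ for which there is $y\in N_P(Q\phi)$ with $(g^x)\phi=(g\phi)^y$ for all $g\in Q$. For $Q\le P$, the normalizer $N_{\mathcal F}(Q)$ is the system on $N_P(Q)$ whose morphisms $R\to S$ (for $R,S\le N_P(Q)$) are those $\phi\in\operatorname{Hom}_{\mathcal F}(R,S)$ that extend to some $\bar\phi\in\operatorname{Hom}_{\mathcal F}(QR,QS)$ with $\bar\phi|_Q$ an automorphism of $Q$. By $\mathcal F_Q(Q)$ we denote the fusion system on $Q$ whose morphisms are the maps between subgroups of $Q$ induced by conjugation by elements of $Q$. A subsystem $\mathcal E$ of $\mathcal F$ on a subgroup $Q$ (a fusion system on $Q$ all of whose morphisms lie in $\mathcal F$) is normal in $\mathcal F$ if it is saturated, $Q$ is strongly $\mathcal F$-closed (every $\mathcal F$-morphism whose domain is contained in $Q$ has its image contained in $Q$), and for all $R\le S\le Q$, $\phi\in\operatorname{Hom}_{\mathcal E}(R,S)$ and $\psi\in\operatorname{Hom}_{\mathcal F}(S,P)$, the map $\psi^{-1}\phi\psi$ lies in $\operatorname{Hom}_{\mathcal E}(R\psi,Q)$. Theorem. Let $\mathcal F$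 be a saturated fusion system on the finite $p$-group $P$, and let $Q\le P$. Then $\mathcal F=N_{\mathcal F}(Q)$ if and only if $\mathcal F_Q(Q)$ is a normal subsystem of $\mathcal F$. -/

import Mathlib

/-!
Fusion systems on subgroups of a group `G`. Following the usual convention in this area, elements
act by conjugation from the right, `x ^ g = g⁻¹ * x * g`. The objects of a system on `P ≤ G` are
the subgroups of `P`.
-/

/-- A prefusion system on a subgroup `carrier` of `G`: for any two subgroups `Q, R` of `carrier`, a
set of injective homomorphisms `Q → R`. (There are no morphisms between other subgroups of `G`.) -/
@[ext]
structure PrefusionSystem (G : Type*) [Group G] where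
  /-- The group `P` on which the system lives. -/
  carrier : Subgroup G
  /-- The set of morphisms from `Q` to `R`. -/
  Hom : ∀ Q R : Subgroup G, Set (Q →* R)
  source_le : ∀ {Q R : Subgroup G} {φ : Q →* R}, φ ∈ Hom Q R → Q ≤ carrier
  target_le : ∀ {Q R : Subgroup G} {φ : Q →* R}, φ ∈ Hom Q R → R ≤ carrier
  injective : ∀ {Q R : Subgroup G} {φ : Q →* R}, φ ∈ Hom Q R → Function.Injective φ

namespace PrefusionSystem

variable {G : Type*} [Group G]

/-- The image `Qφ` of `φ : Q → R`, as a subgroup of `G`. -/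
def image {Q R : Subgroup G} (φ : Q →* R) : Subgroup G :=
  (R.subtype.comp φ).range

/-- The homomorphism `φ : Q → R`, regarded as a surjective homomorphism `Q → Qφ`. -/
def toImage {Q R : Subgroup G} (φ : Q →* R) : Q →* image φ :=
  (R.subtype.comp φ).rangeRestrict

/-- `ψ : Q' → R'` extends `φ : Q → R`: `Q ≤ Q'`, and `ψ` agrees with `φ` on `Q`. -/
def Extends {Q' R' Q R : Subgroup G} (ψ : Q' →* R') (φ : Q →* R) : Prop :=
  ∃ h : Q ≤ Q', ∀ x : Q, (ψ (Subgroup.inclusion h x) : G) = φ x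

/-- The axioms of a fusion system. -/
structure IsFusionSystem (F : PrefusionSystem G) : Prop where
  comp_mem : ∀ {Q R S : Subgroup G} {φ : Q →* R} {ψ : R →* S},
    φ ∈ F.Hom Q R → ψ ∈ F.Hom R S → ψ.comp φ ∈ F.Hom Q S
  /-- Conjugation by any `g ∈ P` with `Q ^ g ≤ R` is a morphism `Q → R`. -/
  conj_mem : ∀ {Q R : Subgroup G}, Q ≤ F.carrier → R ≤ F.carrier →
    ∀ g ∈ F.carrier, ∀ φ : Q →* R, (∀ x : Q, (φ x : G) = g⁻¹ * x * g) → φ ∈ F.Hom Q R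
  toImage_mem : ∀ {Q R : Subgroup G} {φ : Q →* R},
    φ ∈ F.Hom Q R → toImage φ ∈ F.Hom Q (image φ)
  symm_mem : ∀ {Q R : Subgroup G} (e : Q ≃* R),
    e.toMonoidHom ∈ F.Hom Q R → e.symm.toMonoidHom ∈ F.Hom R Q

/-- The group `Aut_F(Q)` of all `F`-automorphisms of `Q ≤ P`. -/
def IsFusionSystem.aut {F : PrefusionSystem G} (hF : F.IsFusionSystem) (Q : Subgroup G)
    (hQ : Q ≤ F.carrier) : Subgroup (MulAut Q) where
  carrier := {α | α.toMonoidHom ∈ F.Hom Q Q}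
  one_mem' := hF.conj_mem hQ hQ 1 (one_mem _) _ fun x => by simp
  mul_mem' := fun {_ _} ha hb => hF.comp_mem hb ha
  inv_mem' := fun {α} ha => hF.symm_mem α ha

/-- The group `Aut_P(Q)` of all automorphisms of `Q` induced by conjugation by elements
of `N_P(Q)`. -/
def conjAut (P Q : Subgroup G) : Subgroup (MulAut Q) :=
  (P.subgroupOf (Subgroup.normalizer (Q : Set G))).map Q.normalizerMonoidHom

/-- The normalizer `N_P(Q)`. -/
def norm (P Q : Subgroup G) : Subgroup G :=
  P ⊓ Subgroup.normalizer (Q : Set G)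

/-- `Q` is fully normalized: `|N_P(Q)| ≥ |N_P(R)|` for every `R` that is `F`-isomorphic to `Q`. -/
def FullyNormalized (F : PrefusionSystem G) (Q : Subgroup G) : Prop :=
  Q ≤ F.carrier ∧ ∀ (R : Subgroup G) (e : Q ≃* R), e.toMonoidHom ∈ F.Hom Q R →
    Nat.card (norm F.carrier R) ≤ Nat.card (norm F.carrier Q)

/-- The group `N_φ` for `φ : Q → R`: all `x ∈ N_P(Q)` such that, for some `y ∈ N_P(Qφ)`,
`(g ^ x)φ = (gφ) ^ y` for all `g ∈ Q`. -/
def extensionGroup (P : Subgroup G) {Q R : Subgroup G} (φ : Q →* R) : Subgroup G where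
  carrier := {x | x ∈ norm P Q ∧ ∃ y ∈ norm P (image φ),
    ∀ g h : Q, (h : G) = x⁻¹ * g * x → (φ h : G) = y⁻¹ * φ g * y}
  one_mem' := ⟨one_mem _, 1, one_mem _, fun g h hh => by
    have : h = g := Subtype.ext (by simpa using hh)
    simp [this]⟩
  mul_mem' := by
    rintro a b ⟨ha, y, hy, hay⟩ ⟨hb, z, hz, hbz⟩
    refine ⟨mul_mem ha hb, y * z, mul_mem hy hz, fun g h hh => ?_⟩
    have hk : a⁻¹ * (g : G) * a ∈ Q := (Subgroup.mem_normalizer_iff''.1 ha.2 g).1 g.2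
    have h1 := hay g ⟨_, hk⟩ rfl
    have h2 := hbz ⟨_, hk⟩ h (by rw [hh]; group)
    rw [h2, h1]; group
  inv_mem' := by
    rintro a ⟨ha, y, hy, hay⟩
    refine ⟨inv_mem ha, y⁻¹, inv_mem hy, fun g h hh => ?_⟩
    have h1 := hay h g (by rw [hh]; group)
    rw [h1]; group

/-- A saturated fusion system (for the prime `p`) on `P`. -/
structure IsSaturated (p : ℕ) (F : PrefusionSystem G) : Prop extends F.IsFusionSystem where
  /-- `Aut_P(P)` is a Sylow `p`-subgroup of `Aut_F(P)`. -/
  sylow : ∃ S : Sylow p (toIsFusionSystem.aut F.carrier le_rfl),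
    (S : Subgroup (toIsFusionSystem.aut F.carrier le_rfl)).map (Subgroup.subtype _) =
      conjAut F.carrier F.carrier
  /-- Every morphism `φ : Q → P` such that `Qφ` is fully normalized extends to a morphism
  `N_φ → P`. -/
  extension : ∀ (Q : Subgroup G), ∀ φ ∈ F.Hom Q F.carrier, F.FullyNormalized (image φ) →
    ∃ ψ ∈ F.Hom (extensionGroup F.carrier φ) F.carrier, Extends ψ φ

/-- `Q` is strongly `F`-closed: a morphism whose domain is a subgroup of `Q` has its image
in `Q`. -/
def StronglyClosed (F : PrefusionSystem G) (Q : Subgroup G) : Prop :=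
  Q ≤ F.carrier ∧ ∀ (R S : Subgroup G), R ≤ Q → ∀ φ ∈ F.Hom R S, image φ ≤ Q

/-- `E` is a subsystem of `F`. -/
def IsSubsystem (E F : PrefusionSystem G) : Prop :=
  E.IsFusionSystem ∧ E.carrier ≤ F.carrier ∧ ∀ Q R : Subgroup G, E.Hom Q R ⊆ F.Hom Q R

/-- The subsystem `E`, on `Q`, is `F`-invariant: `Q` is strongly `F`-closed and, for all
`R ≤ S ≤ Q`, `φ ∈ Hom_E(R, S)` and `ψ ∈ Hom_F(S, P)`, the map `ψ⁻¹φψ` (maps written on the right;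
it sends `rψ` to `rφψ`) lies in `Hom_E(Rψ, Q)`. -/
structure IsInvariant (E F : PrefusionSystem G) : Prop where
  isSubsystem : IsSubsystem E F
  stronglyClosed : F.StronglyClosed E.carrier
  conj_mem : ∀ (R S : Subgroup G) (hRS : R ≤ S), S ≤ E.carrier →
    ∀ φ ∈ E.Hom R S, ∀ ψ ∈ F.Hom S F.carrier,
      ∃ χ ∈ E.Hom (image (ψ.comp (Subgroup.inclusion hRS))) E.carrier,
        ∀ r : R, (χ (toImage (ψ.comp (Subgroup.inclusion hRS)) r) : G) = ψ (φ r)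

/-- `E` is a normal subsystem of `F`: it is `F`-invariant and saturated. -/
def IsNormalSubsystem (p : ℕ) (E F : PrefusionSystem G) : Prop :=
  IsInvariant E F ∧ E.IsSaturated p

/-- The fusion system `F_Q(Q)` on `Q`, whose morphisms are induced by conjugation by elements
of `Q`. -/
def inner (Q : Subgroup G) : PrefusionSystem G where
  carrier := Q
  Hom R S := {φ | R ≤ Q ∧ S ≤ Q ∧ ∃ g ∈ Q, ∀ x : R, (φ x : G) = g⁻¹ * x * g}
  source_le h := h.1
  target_le h := h.2.1
  injective := by
    rintro R S φ ⟨-, -, g, -, hg⟩ x y hxy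
    have h := congrArg (Subtype.val) hxy
    rw [hg, hg] at h
    exact Subtype.ext (by simpa using h)

/-- The normalizer `N_F(Q)` of `Q ≤ P` in `F`, a system on `N_P(Q)`: its morphisms `R → S` are
the morphisms of `F` that extend to a morphism `QR → QS` of `F` which induces an automorphism
of `Q`. (Here `QR` is the join of `Q` and `R`, because `R` normalizes `Q`.) -/
def normalizer (F : PrefusionSystem G) (Q : Subgroup G) : PrefusionSystem G where
  carrier := norm F.carrier Q
  Hom R S := {φ | R ≤ norm F.carrier Q ∧ S ≤ norm F.carrier Q ∧ φ ∈ F.Hom R S ∧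
    ∃ ψ ∈ F.Hom (Q ⊔ R) (Q ⊔ S), Extends ψ φ ∧ ∃ α : MulAut Q, Extends ψ α.toMonoidHom}
  source_le h := h.1
  target_le h := h.2.1
  injective h := F.injective h.2.2.1

end PrefusionSystem

/-!
For fully normalized `T`, the group `Aut_P(T)` is a Sylow `p`-subgroup of `Aut_F(T)`. If `F_Q(Q)`
is invariant, the `F`-automorphisms of `T` that act on `T ∩ Q` as conjugation by an element of `Q`
and leave the cosets of `T ∩ Q` invariant form a normal `p`-subgroup of `Aut_F(T)`, which therefore
lies in `Aut_P(T)`. Hence `N_Q(R) ≤ N_e` for every `F`-isomorphism `e : R → T`. As `N_Q(R)` is not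
contained in `R` unless `Q` is, `e` extends to a larger group, and after finitely many steps
to `QR`; the general case follows by composing with isomorphisms to fully normalized groups.

Conversely, if `F = N_F(Q)`, a morphism `ψ` on a subgroup of `Q` is the restriction of an
automorphism `α` of `Q`, so `ψ` turns conjugation by `g` into conjugation by `gα`.
-/

namespace PrefusionSystem

variable {G : Type*} [Group G]

section Groups

variable {p : ℕ} [Fact p.Prime]

theorem lt_norm {H K : Subgroup G} [Finite K] (hK : IsPGroup p K) (h : H < K) :
    H < norm K H := by
  have := hK.isNilpotent
  have hlt : H.subgroupOf K < ⊤ := lt_top_iff_ne_top.2 (mt Subgroup.subgroupOf_eq_top.1 h.not_ge)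
  obtain ⟨x, hx, hxH⟩ :=
    SetLike.exists_of_lt (Group.normalizerCondition_of_isNilpotent _ hlt)
  rw [← Subgroup.subgroupOf_normalizer_eq h.le] at hx
  exact lt_of_le_of_ne (le_inf h.le Subgroup.le_normalizer)
    fun heq => hxH (Subgroup.mem_subgroupOf.2 (heq.ge ⟨x.2, hx⟩))

theorem not_inf_normalizer_le {Q R : Subgroup G} [Finite (Q ⊔ R : Subgroup G)]
    (hp : IsPGroup p (Q ⊔ R : Subgroup G)) (hRQ : R ≤ Subgroup.normalizer (Q : Set G))
    (hQR : ¬ Q ≤ R) : ¬ Q ⊓ Subgroup.normalizer (R : Set G) ≤ R := by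
  intro hle
  obtain ⟨x, ⟨hx, hxN⟩, hxR⟩ := SetLike.exists_of_lt (lt_norm hp (right_lt_sup.2 hQR))
  replace hx : x ∈ ((Q ⊔ R : Subgroup G) : Set G) := hx
  rw [Subgroup.coe_mul_of_right_le_normalizer_left Q R hRQ] at hx
  obtain ⟨q, hq, r, hr, rfl⟩ := hx
  have hqN : q ∈ Subgroup.normalizer (R : Set G) :=
    (Subgroup.mul_mem_cancel_right _ (Subgroup.le_normalizer hr)).1 hxN
  exact hxR (mul_mem (hle ⟨hq, hqN⟩) hr)

theorem le_normalizer_of_conj_mem {H K : Subgroup G} (h : ∀ g ∈ H, ∀ x ∈ K, g * x * g⁻¹ ∈ K) :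
    H ≤ Subgroup.normalizer (K : Set G) := fun g hg =>
  Subgroup.mem_normalizer_iff.2 fun x => ⟨h g hg x, fun hx => by
    simpa [mul_assoc] using h g⁻¹ (inv_mem hg) _ hx⟩

/-- It suffices to test the elements of `p`-power order because `C` is a proper subgroup of its
normalizer in any larger `p`-group. -/
theorem exists_sylow_coe_eq {A : Type*} [Group A] [Finite A] {C : Subgroup A} (hC : IsPGroup p C)
    (h : ∀ a ∈ Subgroup.normalizer (C : Set A), (∃ k, a ^ p ^ k = 1) → a ∈ C) :
    ∃ S : Sylow p A, (S : Subgroup A) = C := by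
  obtain ⟨S, hCS⟩ := hC.exists_le_sylow
  refine ⟨S, le_antisymm ?_ hCS⟩
  by_contra hSC
  obtain ⟨a, ⟨haS, haN⟩, haC⟩ :=
    SetLike.exists_of_lt (lt_norm S.isPGroup' (lt_of_le_not_ge hCS hSC))
  obtain ⟨k, hk⟩ := S.isPGroup' ⟨a, haS⟩
  exact haC (h a haN ⟨k, congrArg Subtype.val hk⟩)

theorem exists_conj_mem_sylow {A : Type*} [Group A] [Finite A] (S : Sylow p A) {a : A}
    (ha : ∃ k, a ^ p ^ k = 1) : ∃ b, b * a * b⁻¹ ∈ S := by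
  obtain ⟨k, hk⟩ := ha
  obtain ⟨j, -, hj⟩ := (Nat.dvd_prime_pow Fact.out).1 (orderOf_dvd_of_pow_eq_one hk)
  have hp : IsPGroup p (Subgroup.zpowers a) := .of_card ((Nat.card_zpowers a).trans hj)
  obtain ⟨S', haS'⟩ := hp.exists_le_sylow
  obtain ⟨b, rfl⟩ := MulAction.exists_smul_eq A S' S
  exact ⟨b, Subgroup.smul_mem_pointwise_smul a (MulAut.conj b) _ (haS' (Subgroup.mem_zpowers a))⟩

theorem exists_pow_eq_self_and_pow_pow_eq_one {A B : Type*} [Group A] [Finite A] [Group B]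
    (a : A) {b : B} (hb : ∃ k, b ^ p ^ k = 1) : ∃ n, b ^ n = b ∧ ∃ j, (a ^ n) ^ p ^ j = 1 := by
  obtain ⟨k, hk⟩ := hb
  obtain ⟨j, m, hm, ham⟩ :=
    Nat.exists_eq_pow_mul_and_not_dvd (orderOf_pos a).ne' p (Fact.out : p.Prime).ne_one
  have hcop : (p ^ k).Coprime m :=
    Nat.Coprime.pow_left k ((Nat.Prime.coprime_iff_not_dvd Fact.out).2 hm)
  obtain ⟨n, hn1, hn0⟩ := Nat.chineseRemainder hcop 1 0
  refine ⟨n, ?_, j, ?_⟩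
  · simpa using pow_eq_pow_iff_modEq.2 (hn1.of_dvd (orderOf_dvd_of_pow_eq_one hk))
  · rw [← pow_mul, ← orderOf_dvd_iff_pow_eq_one, ham, mul_comm n]
    exact mul_dvd_mul_left _ ((Nat.modEq_zero_iff_dvd).1 hn0)

theorem le_induction_of_card_lt {P : Subgroup G} [Finite P] {motive : Subgroup G → Prop}
    (step : ∀ R ≤ P, (∀ S ≤ P, Nat.card R < Nat.card S → motive S) → motive R)
    (R : Subgroup G) (hR : R ≤ P) : motive R := by
  induction hn : Nat.card P - Nat.card R using Nat.strong_induction_on generalizing R with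
  | _ n ih =>
    refine step R hR fun S hS hRS => ih _ ?_ S hS rfl
    have := Subgroup.card_le_of_le hS
    omega

end Groups

section Automorphisms

variable {P R S T : Subgroup G}

theorem mem_conjAut {α : MulAut T} :
    α ∈ conjAut P T ↔ ∃ y ∈ norm P T, ∀ x : T, (α x : G) = y * x * y⁻¹ := by
  constructor
  · rintro ⟨y, hy, rfl⟩
    exact ⟨y, ⟨hy, y.2⟩, fun x => rfl⟩
  · rintro ⟨y, ⟨hyP, hyN⟩, h⟩
    exact ⟨⟨y, hyN⟩, hyP, MulEquiv.ext fun x => Subtype.ext (h x).symm⟩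

theorem conjAut_isPGroup {p : ℕ} (hP : IsPGroup p P) (T : Subgroup G) :
    IsPGroup p (conjAut P T) :=
  hP.comap_subtype.map _

theorem image_toMonoidHom (e : R ≃* T) : image e.toMonoidHom = T := by
  ext y
  exact ⟨fun ⟨x, hx⟩ => hx ▸ (e x).2, fun hy => ⟨e.symm ⟨y, hy⟩, by simp⟩⟩

theorem image_le (φ : R →* S) : image φ ≤ S := by
  rintro _ ⟨x, rfl⟩
  exact (φ x).2

theorem le_extensionGroup (hR : R ≤ P) (φ : R →* S) (hφ : image φ ≤ P) :
    R ≤ extensionGroup P φ := fun x hx => by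
  have hφx : (φ ⟨x, hx⟩ : G) ∈ image φ := ⟨⟨x, hx⟩, rfl⟩
  refine ⟨⟨hR hx, Subgroup.le_normalizer hx⟩, φ ⟨x, hx⟩,
    ⟨hφ hφx, Subgroup.le_normalizer hφx⟩, fun g h hh => ?_⟩
  obtain rfl : h = ⟨x, hx⟩⁻¹ * g * ⟨x, hx⟩ := Subtype.ext hh
  simp

theorem mem_extensionGroup_of_congr_mem_conjAut (e : R ≃* T) {x : G} (hx : x ∈ norm P R)
    (h : MulAut.congr e (R.normalizerMonoidHom ⟨x, hx.2⟩) ∈ conjAut P T) :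
    x ∈ extensionGroup P e.toMonoidHom := by
  obtain ⟨y, hy, hxy⟩ := mem_conjAut.1 h
  refine ⟨hx, y, by rwa [image_toMonoidHom], fun g k hk => ?_⟩
  have hg : R.normalizerMonoidHom ⟨x, hx.2⟩ k = g := by
    refine Subtype.ext ?_
    change x * k * x⁻¹ = g
    rw [hk]
    group
  have := hxy (e k)
  simp only [MulAut.congr_apply, MulEquiv.trans_apply, MulEquiv.symm_apply_apply, hg] at this
  change (e k : G) = y⁻¹ * e g * y
  rw [this]
  group

end Automorphisms

section Extends

variable {R T R' T' R'' T'' : Subgroup G}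

theorem Extends.le {ψ : R' →* T'} {φ : R →* T} (h : Extends ψ φ) : R ≤ R' := h.1

theorem Extends.apply {ψ : R' →* T'} {φ : R →* T} (h : Extends ψ φ) {x : G} (hx : x ∈ R) :
    (ψ ⟨x, h.le hx⟩ : G) = φ ⟨x, hx⟩ :=
  h.2 ⟨x, hx⟩

theorem Extends.trans {χ : R'' →* T''} {ψ : R' →* T'} {φ : R →* T} (h' : Extends χ ψ)
    (h : Extends ψ φ) : Extends χ φ :=
  ⟨h.le.trans h'.le, fun x => (h'.apply (h.le x.2)).trans (h.apply x.2)⟩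

theorem Extends.of_extends {χ : R'' →* T''} {ψ : R' →* T'} {φ : R →* T} (hφ : Extends χ φ)
    (hψ : Extends χ ψ) (hR : R ≤ R') : Extends ψ φ :=
  ⟨hR, fun x => (hψ.apply (hR x.2)).symm.trans (hφ.apply x.2)⟩

theorem Extends.target_le {ψ : R' →* T'} {e : R ≃* T} (h : Extends ψ e.toMonoidHom) :
    T ≤ T' := fun y hy => by
  have := h.2 (e.symm ⟨y, hy⟩)
  simp only [MulEquiv.toMonoidHom_eq_coe, MonoidHom.coe_coe, MulEquiv.apply_symm_apply] at this
  exact this ▸ SetLike.coe_mem _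

theorem Extends.comp {U U' : Subgroup G} {e' : R' ≃* T'} {e : R ≃* T} {f' : T' ≃* U'} {f : T ≃* U}
    (he : Extends e'.toMonoidHom e.toMonoidHom) (hf : Extends f'.toMonoidHom f.toMonoidHom) :
    Extends (e'.trans f').toMonoidHom (e.trans f).toMonoidHom := by
  refine ⟨he.le, fun x => ?_⟩
  change (f' (e' ⟨x, he.le x.2⟩) : G) = f (e x)
  have hx : e' ⟨x, he.le x.2⟩ = Subgroup.inclusion hf.le (e x) := Subtype.ext (he.2 x)
  rw [hx]
  exact hf.2 (e x)

theorem Extends.symm {e' : R' ≃* T'} {e : R ≃* T} (h : Extends e'.toMonoidHom e.toMonoidHom) :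
    Extends e'.symm.toMonoidHom e.symm.toMonoidHom := by
  refine ⟨h.target_le, fun y => ?_⟩
  suffices e'.symm ⟨y, h.target_le y.2⟩ = Subgroup.inclusion h.le (e.symm y) from
    congrArg Subtype.val this
  rw [MulEquiv.symm_apply_eq]
  refine Subtype.ext ((?_ : (y : G) = e (e.symm y)).trans (h.2 (e.symm y)).symm)
  rw [MulEquiv.apply_symm_apply]

theorem Extends.target_eq_sup {S S' U : Subgroup G} {ψ : (S ⊔ R : Subgroup G) ≃* U} {f : S ≃* S'}
    {e : R ≃* T} (hf : Extends ψ.toMonoidHom f.toMonoidHom)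
    (he : Extends ψ.toMonoidHom e.toMonoidHom) : U = S' ⊔ T := by
  refine le_antisymm (fun y hy => ?_) (sup_le hf.target_le he.target_le)
  let K := (S' ⊔ T).comap (U.subtype.comp ψ.toMonoidHom)
  have hK : S ⊔ R ≤ K.map (S ⊔ R).subtype := by
    refine sup_le (fun x hx => ⟨⟨x, hf.le hx⟩, ?_, rfl⟩) fun x hx => ⟨⟨x, he.le hx⟩, ?_, rfl⟩
    · exact Subgroup.mem_sup_left (Set.mem_of_eq_of_mem (hf.apply hx) (SetLike.coe_mem _))
    · exact Subgroup.mem_sup_right (Set.mem_of_eq_of_mem (he.apply hx) (SetLike.coe_mem _))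
  obtain ⟨x, hx, hxy⟩ := hK (ψ.symm ⟨y, hy⟩).2
  obtain rfl : x = ψ.symm ⟨y, hy⟩ := Subtype.ext hxy
  simpa [K] using hx

theorem Extends.pow {ψ : MulAut R'} {φ : MulAut R} (h : Extends ψ.toMonoidHom φ.toMonoidHom)
    (n : ℕ) : Extends (ψ ^ n).toMonoidHom (φ ^ n).toMonoidHom := by
  induction n with
  | zero => exact ⟨h.le, fun _ => rfl⟩
  | succ n ih =>
    rw [pow_succ, pow_succ]
    exact h.comp ih

theorem Extends.apply_conj {ψ : R' →* T'} {φ : R →* T} (h : Extends ψ φ) (g : R') (x y : R)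
    (hy : (y : G) = g * x * (g : G)⁻¹) : (φ y : G) = ψ g * φ x * (ψ g : G)⁻¹ := by
  have hmul : Subgroup.inclusion h.le y = g * Subgroup.inclusion h.le x * g⁻¹ := Subtype.ext hy
  rw [← h.2 y, ← h.2 x, hmul, map_mul, map_mul, map_inv]
  rfl

theorem Extends.le_normalizer {e' : R' ≃* T'} {e : R ≃* T}
    (h : Extends e'.toMonoidHom e.toMonoidHom) (hR : R' ≤ Subgroup.normalizer (R : Set G)) :
    T' ≤ Subgroup.normalizer (T : Set G) := by
  refine le_normalizer_of_conj_mem fun y hy z hz => ?_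
  obtain ⟨g, hg⟩ := e'.surjective ⟨y, hy⟩
  obtain ⟨x, hx⟩ := e.surjective ⟨z, hz⟩
  have hgx : (g : G) * x * (g : G)⁻¹ ∈ R := (Subgroup.mem_normalizer_iff.1 (hR g.2) _).1 x.2
  have key : (e ⟨_, hgx⟩ : G) = e' g * e x * (e' g : G)⁻¹ := h.apply_conj g x ⟨_, hgx⟩ rfl
  rw [hg, hx] at key
  exact key ▸ SetLike.coe_mem _

end Extends

variable {F : PrefusionSystem G} {Q R S T U : Subgroup G}

section Isomorphisms

/-- The isomorphisms `R → T` of the system `F`. -/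
def Iso (F : PrefusionSystem G) (R T : Subgroup G) : Set (R ≃* T) :=
  {e | e.toMonoidHom ∈ F.Hom R T}

/-- The isomorphism `R → Rφ` induced by an injective homomorphism `φ : R → S`. -/
noncomputable def isoImage (φ : R →* S) (hφ : Function.Injective φ) : R ≃* image φ :=
  MulEquiv.ofBijective (toImage φ)
    ⟨fun _ _ hxy => hφ (Subtype.ext (congrArg (Subtype.val : image φ → G) hxy)),
      MonoidHom.rangeRestrict_surjective _⟩

theorem IsFusionSystem.isoImage_mem (hF : F.IsFusionSystem) {φ : R →* S} (hφ : φ ∈ F.Hom R S) :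
    isoImage φ (F.injective hφ) ∈ F.Iso R (image φ) :=
  hF.toImage_mem hφ

theorem IsFusionSystem.inclusion_mem (hF : F.IsFusionSystem) (hRS : R ≤ S) (hS : S ≤ F.carrier) :
    Subgroup.inclusion hRS ∈ F.Hom R S :=
  hF.conj_mem (hRS.trans hS) hS 1 (one_mem _) _ fun x => by simp

theorem IsFusionSystem.refl_mem (hF : F.IsFusionSystem) (hR : R ≤ F.carrier) :
    MulEquiv.refl R ∈ F.Iso R R :=
  hF.inclusion_mem le_rfl hR

theorem IsFusionSystem.comp_inclusion_mem (hF : F.IsFusionSystem) {φ : R →* T}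
    (hφ : φ ∈ F.Hom R T) (hSR : S ≤ R) : φ.comp (Subgroup.inclusion hSR) ∈ F.Hom S T :=
  hF.comp_mem (hF.inclusion_mem hSR (F.source_le hφ)) hφ

theorem IsFusionSystem.exists_restrict (hF : F.IsFusionSystem) {φ : R →* T} (hφ : φ ∈ F.Hom R T)
    (hSR : S ≤ R) : ∃ U, ∃ e ∈ F.Iso S U, Extends φ e.toMonoidHom :=
  ⟨_, _, hF.isoImage_mem (hF.comp_inclusion_mem hφ hSR), hSR, fun _ => rfl⟩

theorem IsFusionSystem.exists_fullyNormalized (hF : F.IsFusionSystem) [Finite F.carrier]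
    (hR : R ≤ F.carrier) : ∃ T, F.FullyNormalized T ∧ ∃ e, e ∈ F.Iso R T := by
  let norms : Set ℕ := {n | ∃ T, (∃ e, e ∈ F.Iso R T) ∧ Nat.card (norm F.carrier T) = n}
  have hne : norms.Nonempty := ⟨_, R, ⟨_, hF.refl_mem hR⟩, rfl⟩
  have hbdd : BddAbove norms :=
    ⟨Nat.card F.carrier, by rintro _ ⟨T, -, rfl⟩; exact Subgroup.card_le_of_le inf_le_left⟩
  obtain ⟨T, ⟨e, he⟩, hT⟩ := Nat.sSup_mem hne hbdd
  refine ⟨T, ⟨F.target_le he, fun U f hf => ?_⟩, e, he⟩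
  rw [hT]
  exact le_csSup hbdd ⟨U, ⟨e.trans f, hF.comp_mem he hf⟩, rfl⟩

theorem IsSaturated.exists_extension {p : ℕ} (hF : F.IsSaturated p) {e : R ≃* T}
    (he : e ∈ F.Iso R T) (hT : F.FullyNormalized T) (hRS : R ≤ S)
    (hS : S ≤ extensionGroup F.carrier e.toMonoidHom) :
    ∃ U, ∃ e' ∈ F.Iso S U, Extends e'.toMonoidHom e.toMonoidHom := by
  obtain ⟨ψ, hψ, hext⟩ := hF.extension R ((Subgroup.inclusion hT.1).comp e.toMonoidHom)
    (hF.comp_mem he (hF.inclusion_mem hT.1 le_rfl)) ((image_toMonoidHom e).symm ▸ hT)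
  have hmem := hF.comp_inclusion_mem hψ hS
  exact ⟨_, _, hF.isoImage_mem hmem, hRS, fun x => hext.2 x⟩

end Isomorphisms

section FullyAutomized

instance [Finite S] : Finite (norm S T) :=
  Finite.Set.subset S inf_le_left

/-- `T` is fully automized: `Aut_P(T)` is a Sylow `p`-subgroup of `Aut_F(T)`. -/
def IsFusionSystem.FullyAutomized (hF : F.IsFusionSystem) (p : ℕ) (hT : T ≤ F.carrier) : Prop :=
  ∃ S : Sylow p (hF.aut T hT),
    (S : Subgroup (hF.aut T hT)).map (Subgroup.subtype _) = conjAut F.carrier T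

theorem IsFusionSystem.conjAut_le_aut (hF : F.IsFusionSystem) (hT : T ≤ F.carrier) :
    conjAut F.carrier T ≤ hF.aut T hT := fun α hα => by
  obtain ⟨y, hy, h⟩ := mem_conjAut.1 hα
  exact hF.conj_mem hT hT y⁻¹ (inv_mem hy.1) _ fun x => by simpa using h x

theorem IsSaturated.exists_extension_norm [Finite F.carrier] {p : ℕ} (hF : F.IsSaturated p)
    (hT : F.FullyNormalized T) {φ : MulAut T} (hφ : φ ∈ F.Iso T T)
    (hnorm : φ ∈ Subgroup.normalizer (conjAut F.carrier T : Set (MulAut T))) :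
    ∃ ψ ∈ F.Iso (norm F.carrier T) (norm F.carrier T), Extends ψ.toMonoidHom φ.toMonoidHom := by
  have hN : norm F.carrier T ≤ extensionGroup F.carrier φ.toMonoidHom := fun x hx =>
    mem_extensionGroup_of_congr_mem_conjAut φ hx
      ((Subgroup.mem_normalizer_iff.1 hnorm _).1 ⟨⟨x, hx.2⟩, hx.1, rfl⟩)
  obtain ⟨U, ψ, hψ, hext⟩ := hF.exists_extension hφ hT (le_inf hT.1 Subgroup.le_normalizer) hN
  have hU : U = norm F.carrier T :=
    Subgroup.eq_of_le_of_card_ge (le_inf (F.target_le hψ) (hext.le_normalizer inf_le_right))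
      (Nat.card_congr ψ.toEquiv).le
  subst hU
  exact ⟨ψ, hψ, hext⟩

theorem IsFusionSystem.FullyAutomized.exists_congr_mem_conjAut {p : ℕ} [Fact p.Prime]
    {N M : Subgroup G} [Finite M] {hF : F.IsFusionSystem} {hM : M ≤ F.carrier}
    (h : hF.FullyAutomized p hM) {τ : N ≃* M} (hτ : τ ∈ F.Iso N M) {ψ : MulAut N}
    (hψ : ψ ∈ F.Iso N N) (hpow : ∃ j, ψ ^ p ^ j = 1) :
    ∃ s ∈ F.Iso N M, MulAut.congr s ψ ∈ conjAut F.carrier M := by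
  obtain ⟨S, hS⟩ := h
  obtain ⟨j, hj⟩ := hpow
  let β : hF.aut M hM :=
    ⟨MulAut.congr τ ψ, hF.comp_mem (hF.symm_mem _ hτ) (hF.comp_mem hψ hτ)⟩
  have hβ : β ^ p ^ j = 1 := Subtype.ext (by
    rw [Subgroup.coe_pow, ← map_pow, hj, map_one, Subgroup.coe_one])
  obtain ⟨a, ha⟩ := exists_conj_mem_sylow S ⟨j, hβ⟩
  refine ⟨τ.trans (a : MulAut M), hF.comp_mem hτ a.2, ?_⟩
  rw [← hS]
  exact ⟨a * β * a⁻¹, ha, rfl⟩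

theorem FullyNormalized.norm_eq_of_extends [Finite F.carrier] (hT : F.FullyNormalized T)
    {M : Subgroup G} {s : norm F.carrier T ≃* M} (hs : s ∈ F.Iso (norm F.carrier T) M)
    {s₀ : T ≃* U} (hs₀ : s₀ ∈ F.Iso T U) (hext : Extends s.toMonoidHom s₀.toMonoidHom) :
    norm F.carrier U = M := by
  have hMU : M ≤ norm F.carrier U := le_inf (F.target_le hs) (hext.le_normalizer inf_le_right)
  exact (Subgroup.eq_of_le_of_card_ge hMU
    ((hT.2 U s₀ hs₀).trans (Nat.card_congr s.toEquiv).le)).symm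

theorem FullyNormalized.mem_conjAut_of_congr_mem_conjAut [Finite F.carrier]
    (hF : F.IsFusionSystem) (hT : F.FullyNormalized T) {M : Subgroup G}
    {s : norm F.carrier T ≃* M} (hs : s ∈ F.Iso (norm F.carrier T) M) {φ : MulAut T}
    {ψ : MulAut (norm F.carrier T)} (hext : Extends ψ.toMonoidHom φ.toMonoidHom)
    (hsψ : MulAut.congr s ψ ∈ conjAut F.carrier M) : φ ∈ conjAut F.carrier T := by
  have hTN : T ≤ norm F.carrier T := le_inf hT.1 Subgroup.le_normalizer
  obtain ⟨U, s₀, hs₀, hss₀⟩ := hF.exists_restrict hs hTN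
  obtain ⟨y, hy, hψy⟩ := mem_conjAut.1 hsψ
  have hφy : ∀ z : U, (MulAut.congr s₀ φ z : G) = y * z * y⁻¹ := fun z =>
    ((hss₀.symm.comp (hext.comp hss₀)).2 z).symm.trans (hψy _)
  have hyU : y ∈ norm F.carrier U := by
    have : Finite U := Finite.Set.subset F.carrier (F.target_le hs₀)
    exact ⟨hy.1, Subgroup.mem_normalizer_fintype fun z hz =>
      (hφy ⟨z, hz⟩).symm ▸ SetLike.coe_mem _⟩
  have hyM : y ∈ M := (hT.norm_eq_of_extends hs hs₀ hss₀) ▸ hyU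
  refine mem_conjAut.2 ⟨s.symm ⟨y, hyM⟩, SetLike.coe_mem _, fun t => ?_⟩
  have hst : (s₀ (φ t) : G) = y * s₀ t * y⁻¹ := by simpa using hφy (s₀ t)
  simpa using hss₀.symm.apply_conj ⟨y, hyM⟩ (s₀ t) (s₀ (φ t)) hst

theorem IsSaturated.fullyAutomized [Finite F.carrier] {p : ℕ} [Fact p.Prime]
    (hP : IsPGroup p F.carrier) (hF : F.IsSaturated p) {T : Subgroup G}
    (hT : F.FullyNormalized T) : hF.FullyAutomized p hT.1 := by
  refine le_induction_of_card_lt (motive := fun T =>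
    ∀ hT : F.FullyNormalized T, hF.FullyAutomized p hT.1) (fun T hTP ih hT => ?_) T hT.1 hT
  rcases hTP.eq_or_lt with rfl | hlt
  · exact hF.sylow
  have : Finite T := Finite.Set.subset F.carrier hTP
  have hle := hF.conjAut_le_aut hTP
  suffices ∃ S : Sylow p (hF.aut T hTP),
      (S : Subgroup (hF.aut T hTP)) = (conjAut F.carrier T).subgroupOf (hF.aut T hTP) by
    obtain ⟨S, hS⟩ := this
    exact ⟨S, by rw [hS, Subgroup.subgroupOf_map_subtype, inf_of_le_left hle]⟩
  refine exists_sylow_coe_eq (conjAut_isPGroup hP T).comap_subtype fun φ hφ hpow => ?_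
  rw [← SetLike.mem_coe, ← Subgroup.subgroupOf_normalizer_eq hle] at hφ
  obtain ⟨ψ, hψ, hext⟩ := hF.exists_extension_norm hT φ.2 hφ
  obtain ⟨n, hn, hψn⟩ := exists_pow_eq_self_and_pow_pow_eq_one ψ hpow
  obtain ⟨M, hM, τ, hτ⟩ := hF.exists_fullyNormalized (R := norm F.carrier T) inf_le_left
  have hTM : Nat.card T < Nat.card M := by
    have hlt := lt_norm hP hlt
    rw [← Nat.card_congr τ.toEquiv]
    exact lt_of_not_ge fun h => hlt.ne (Subgroup.eq_of_le_of_card_ge hlt.le h)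
  have : Finite M := Finite.Set.subset F.carrier hM.1
  have hψ' : ψ ^ n ∈ hF.aut (norm F.carrier T) inf_le_left := pow_mem hψ n
  obtain ⟨s, hs, hsψ⟩ :=
    (ih M hM.1 hTM hM).exists_congr_mem_conjAut hτ hψ' hψn
  have hextn := hext.pow n
  rw [← Subgroup.coe_pow, hn] at hextn
  exact hT.mem_conjAut_of_congr_mem_conjAut hF.toIsFusionSystem hs hextn hsψ

end FullyAutomized

section StronglyClosed

theorem StronglyClosed.apply_mem (hQ : F.StronglyClosed Q) (hF : F.IsFusionSystem) {φ : R →* T}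
    (hφ : φ ∈ F.Hom R T) {x : R} (hx : (x : G) ∈ Q) : (φ x : G) ∈ Q :=
  hQ.2 (R ⊓ Q) T inf_le_right _ (hF.comp_inclusion_mem hφ inf_le_left) ⟨⟨x, x.2, hx⟩, rfl⟩

theorem StronglyClosed.le_normalizer (hQ : F.StronglyClosed Q) (hF : F.IsFusionSystem) :
    F.carrier ≤ Subgroup.normalizer (Q : Set G) :=
  le_normalizer_of_conj_mem fun g hg x hx => by
    have hmem : (MulAut.conj (⟨g, hg⟩ : F.carrier)).toMonoidHom ∈ F.Hom F.carrier F.carrier :=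
      hF.conj_mem le_rfl le_rfl g⁻¹ (inv_mem hg) _ fun x => by simp
    exact hQ.apply_mem hF hmem (x := ⟨x, hQ.1 hx⟩) hx

theorem StronglyClosed.exists_aut_extends [Finite F.carrier] (hQ : F.StronglyClosed Q)
    (hF : F.IsFusionSystem) {e : R ≃* T} (he : e ∈ F.Iso R T) (hQR : Q ≤ R) :
    ∃ α ∈ F.Iso Q Q, Extends e.toMonoidHom α.toMonoidHom := by
  have : Finite Q := Finite.Set.subset F.carrier hQ.1
  obtain ⟨U, α, hα, hext⟩ := hF.exists_restrict he hQR
  have hU : U = Q := by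
    refine Subgroup.eq_of_le_of_card_ge ?_ (Nat.card_congr α.toEquiv).le
    exact image_toMonoidHom α ▸ hQ.2 Q U le_rfl _ hα
  subst hU
  exact ⟨α, hα, hext⟩

end StronglyClosed

section CosetAut

/-- The automorphisms of `T` that act on `T ∩ Q` as conjugation by an element of `Q` and leave
every coset of `T ∩ Q` in `T` invariant. -/
def cosetAut (Q T : Subgroup G) : Subgroup (MulAut T) where
  carrier := {α | (∃ h ∈ Q, ∀ x : T, (x : G) ∈ Q → (α x : G) = h * x * h⁻¹) ∧
    ∀ x : T, (x : G)⁻¹ * α x ∈ Q}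
  one_mem' := ⟨⟨1, one_mem _, by simp⟩, by simp⟩
  mul_mem' := by
    rintro α β ⟨⟨h, hh, hα⟩, hα'⟩ ⟨⟨k, hk, hβ⟩, hβ'⟩
    refine ⟨⟨h * k, mul_mem hh hk, fun x hx => ?_⟩, fun x => ?_⟩
    · have hβx : (β x : G) ∈ Q := (Subgroup.mul_mem_cancel_left _ (inv_mem hx)).1 (hβ' x)
      rw [MulAut.mul_apply, hα _ hβx, hβ x hx]
      group
    · simpa [mul_assoc] using mul_mem (hβ' x) (hα' (β x))
  inv_mem' := by
    rintro α ⟨⟨h, hh, hα⟩, hα'⟩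
    have hinv : ∀ x : T, (x : G)⁻¹ * (α⁻¹ x : T) ∈ Q := fun x => by
      simpa using inv_mem (hα' (α⁻¹ x))
    refine ⟨⟨h⁻¹, inv_mem hh, fun x hx => ?_⟩, hinv⟩
    have hαx : ((α⁻¹ x : T) : G) ∈ Q := (Subgroup.mul_mem_cancel_left _ (inv_mem hx)).1 (hinv x)
    have := hα _ hαx
    rw [MulAut.apply_inv_self] at this
    rw [this]
    group

theorem pow_apply_eq_mul_pow {H : Type*} [Group H] (β : MulAut H) {x : H}
    (h : β (x⁻¹ * β x) = x⁻¹ * β x) (n : ℕ) : (β ^ n) x = x * (x⁻¹ * β x) ^ n := by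
  induction n with
  | zero => simp
  | succ n ih =>
    rw [pow_succ', MulAut.mul_apply, ih, map_mul, map_pow, h, pow_succ', ← mul_assoc,
      mul_inv_cancel_left]

theorem pow_apply_eq_conj {α : MulAut T} {h : G} (hh : h ∈ Q)
    (hα : ∀ x : T, (x : G) ∈ Q → (α x : G) = h * x * h⁻¹) (n : ℕ) {x : T} (hx : (x : G) ∈ Q) :
    ((α ^ n) x : G) = h ^ n * x * (h ^ n)⁻¹ := by
  induction n with
  | zero => simp
  | succ n ih =>
    have hnx : ((α ^ n) x : G) ∈ Q :=
      ih ▸ mul_mem (mul_mem (pow_mem hh n) hx) (inv_mem (pow_mem hh n))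
    rw [pow_succ', MulAut.mul_apply, hα _ hnx, ih, pow_succ']
    group

theorem cosetAut_isPGroup {p : ℕ} [Fact p.Prime] [Finite Q] (hQ : IsPGroup p Q)
    (T : Subgroup G) : IsPGroup p (cosetAut Q T) := by
  obtain ⟨k, hk⟩ := IsPGroup.iff_card.1 hQ
  have hpow : ∀ x ∈ Q, x ^ p ^ k = 1 := fun x hx => by
    rw [← hk]
    exact congrArg Subtype.val (pow_card_eq_one' (x := (⟨x, hx⟩ : Q)))
  rintro ⟨α, hα⟩
  obtain ⟨⟨h, hh, hαh⟩, -⟩ := id hα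
  have hfix : ∀ x : T, (x : G) ∈ Q → (α ^ p ^ k) x = x := fun x hx =>
    Subtype.ext (by rw [pow_apply_eq_conj hh hαh _ hx, hpow h hh]; group)
  have hcoset := (pow_mem hα (p ^ k)).2
  refine ⟨k + k, Subtype.ext (MulEquiv.ext fun x => ?_)⟩
  have hx := pow_apply_eq_mul_pow (α ^ p ^ k) (hfix (x⁻¹ * (α ^ p ^ k) x) (hcoset x)) (p ^ k)
  rw [← pow_mul, ← pow_add] at hx
  refine hx.trans (Subtype.ext ?_)
  change (x : G) * ((x : G)⁻¹ * (α ^ p ^ k) x) ^ p ^ k = x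
  rw [hpow _ (hcoset x), mul_one]

theorem normalizerMonoidHom_mem_cosetAut (hRQ : R ≤ Subgroup.normalizer (Q : Set G)) {x : G}
    (hx : x ∈ Q) (hxR : x ∈ Subgroup.normalizer (R : Set G)) :
    R.normalizerMonoidHom ⟨x, hxR⟩ ∈ cosetAut Q R := by
  refine ⟨⟨x, hx, fun y _ => rfl⟩, fun y => ?_⟩
  change (y : G)⁻¹ * (x * y * x⁻¹) ∈ Q
  have hxy := (Subgroup.mem_normalizer_iff''.1 (hRQ y.2) x).1 hx
  simpa [mul_assoc] using mul_mem hxy (inv_mem hx)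

end CosetAut

/-- The homomorphism `x ↦ x ^ g` from `R` to `S`. -/
def conjHom (g : G) (h : ∀ x ∈ R, g⁻¹ * x * g ∈ S) : R →* S :=
  ((MulAut.conj g⁻¹).toMonoidHom.comp R.subtype).codRestrict S fun x => by
    simpa using h x x.2

theorem conjHom_apply (g : G) (h : ∀ x ∈ R, g⁻¹ * x * g ∈ S) (x : R) :
    (conjHom g h x : G) = g⁻¹ * x * g := by
  simp [conjHom]

section Invariant

theorem IsInvariant.exists_conj_apply (hI : IsInvariant (inner Q) F) (hS : S ≤ Q) {g : G}
    (hg : g ∈ Q) (hgS : ∀ x ∈ S, g⁻¹ * x * g ∈ S) {ψ : S →* F.carrier}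
    (hψ : ψ ∈ F.Hom S F.carrier) :
    ∃ k ∈ Q, ∀ x : S, (ψ (conjHom g hgS x) : G) = k⁻¹ * ψ x * k := by
  obtain ⟨χ, ⟨-, -, k, hk, hχ⟩, hχψ⟩ := hI.conj_mem S S le_rfl hS (conjHom g hgS)
    ⟨hS, hS, g, hg, conjHom_apply g hgS⟩ ψ hψ
  exact ⟨k, hk, fun x => (hχψ x).symm.trans (hχ _)⟩

theorem IsInvariant.congr_mem_cosetAut (hI : IsInvariant (inner Q) F) (hF : F.IsFusionSystem)
    {e : R ≃* T} (he : e ∈ F.Iso R T) {α : MulAut R} (hα : α ∈ cosetAut Q R) :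
    MulAut.congr e α ∈ cosetAut Q T := by
  have hQ : F.StronglyClosed Q := hI.stronglyClosed
  obtain ⟨⟨h, hh, hαh⟩, hαQ⟩ := hα
  refine ⟨?_, fun y => ?_⟩
  · have hconj : ∀ x ∈ R ⊓ Q, h⁻¹⁻¹ * x * h⁻¹ ∈ R ⊓ Q := fun x hx => by
      rw [inv_inv]
      refine ⟨hαh ⟨x, hx.1⟩ hx.2 ▸ SetLike.coe_mem _, ?_⟩
      exact Q.mul_mem (Q.mul_mem hh hx.2) (Q.inv_mem hh)
    have he' : (Subgroup.inclusion (F.target_le he)).comp e.toMonoidHom ∈ F.Hom R F.carrier :=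
      hF.comp_mem he (hF.inclusion_mem _ le_rfl)
    obtain ⟨k, hk, hψ⟩ := hI.exists_conj_apply inf_le_right (inv_mem hh) hconj
      (hF.comp_inclusion_mem he' inf_le_left)
    refine ⟨k⁻¹, inv_mem hk, fun y hy => ?_⟩
    have hx : (e.symm y : G) ∈ Q := hQ.apply_mem hF (hF.symm_mem e he) hy
    let x : (R ⊓ Q : Subgroup G) := ⟨e.symm y, SetLike.coe_mem _, hx⟩
    have hαx : α (e.symm y) = Subgroup.inclusion inf_le_left (conjHom h⁻¹ hconj x) :=
      Subtype.ext (by simp [conjHom_apply, hαh _ hx, x])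
    calc (MulAut.congr e α y : G) = e (α (e.symm y)) := rfl
      _ = k⁻¹ * e (e.symm y) * k := by rw [hαx]; exact hψ x
      _ = k⁻¹ * y * k⁻¹⁻¹ := by rw [e.apply_symm_apply, inv_inv]
  · have := hQ.apply_mem hF he (x := (e.symm y)⁻¹ * α (e.symm y)) (hαQ _)
    simpa using this

variable {p : ℕ} [Fact p.Prime] [Finite F.carrier]

theorem IsInvariant.mem_conjAut_of_mem_cosetAut (hI : IsInvariant (inner Q) F)
    (hP : IsPGroup p F.carrier) (hF : F.IsSaturated p) (hT : F.FullyNormalized T) {α : MulAut T}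
    (hα : α ∈ F.Iso T T) (hαQ : α ∈ cosetAut Q T) : α ∈ conjAut F.carrier T := by
  have hQ : Q ≤ F.carrier := hI.stronglyClosed.1
  have : Finite Q := Finite.Set.subset F.carrier hQ
  let K := (cosetAut Q T).subgroupOf (hF.aut T hT.1)
  have hK : IsPGroup p K := (cosetAut_isPGroup (hP.to_le hQ) T).comap_subtype
  have : K.Normal := ⟨fun β hβ c => hI.congr_mem_cosetAut hF.toIsFusionSystem c.2 hβ⟩
  obtain ⟨S, hS⟩ := hF.fullyAutomized hP hT
  rw [← hS]
  exact ⟨⟨α, hα⟩, hK.le_sylow_of_normal S hαQ, rfl⟩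

theorem IsInvariant.inf_normalizer_le_extensionGroup (hI : IsInvariant (inner Q) F)
    (hP : IsPGroup p F.carrier) (hF : F.IsSaturated p) {e : R ≃* T} (he : e ∈ F.Iso R T)
    (hT : F.FullyNormalized T) :
    Q ⊓ Subgroup.normalizer (R : Set G) ≤ extensionGroup F.carrier e.toMonoidHom := by
  have hQ : F.StronglyClosed Q := hI.stronglyClosed
  rintro x ⟨hxQ, hxR⟩
  have hRP := F.source_le he
  have hx : x ∈ norm F.carrier R := ⟨hQ.1 hxQ, hxR⟩
  have hconj : R.normalizerMonoidHom ⟨x, hxR⟩ ∈ F.Iso R R :=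
    hF.conjAut_le_aut hRP ⟨⟨x, hxR⟩, hx.1, rfl⟩
  refine mem_extensionGroup_of_congr_mem_conjAut e hx (hI.mem_conjAut_of_mem_cosetAut hP hF hT
    (hF.comp_mem (hF.symm_mem e he) (hF.comp_mem hconj he))
    (hI.congr_mem_cosetAut hF.toIsFusionSystem he ?_))
  exact normalizerMonoidHom_mem_cosetAut (hRP.trans (hQ.le_normalizer hF.toIsFusionSystem))
    hxQ hxR

end Invariant

section ExtendsOver

/-- The isomorphism `e : R → T` extends to an isomorphism `QR → QT` of `F`. -/
def ExtendsOver (F : PrefusionSystem G) (Q : Subgroup G) (e : R ≃* T) : Prop :=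
  ∃ e' ∈ F.Iso (Q ⊔ R) (Q ⊔ T), Extends e'.toMonoidHom e.toMonoidHom

theorem ExtendsOver.of_trans (hF : F.IsFusionSystem) {e : R ≃* T} {τ : T ≃* U}
    (heτ : ExtendsOver F Q (e.trans τ)) (hτ : ExtendsOver F Q τ) : ExtendsOver F Q e := by
  obtain ⟨f, hf, hfe⟩ := heτ
  obtain ⟨t, ht, htτ⟩ := hτ
  refine ⟨f.trans t.symm, hF.comp_mem hf (hF.symm_mem t ht), ?_⟩
  have he : (e.trans τ).trans τ.symm = e := by
    ext x
    simp
  exact he ▸ hfe.comp htτ.symm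

theorem StronglyClosed.extendsOver_of_extends [Finite F.carrier] (hQ : F.StronglyClosed Q)
    (hF : F.IsFusionSystem) {e : R ≃* T} {e' : S ≃* U} (he' : e' ∈ F.Iso S U)
    (hext : Extends e'.toMonoidHom e.toMonoidHom) (hQS : Q ≤ S) : ExtendsOver F Q e := by
  obtain ⟨V, f, hf, hfe'⟩ := hF.exists_restrict he' (sup_le hQS hext.le)
  have hfe := hext.of_extends hfe' le_sup_right
  obtain ⟨α, -, hα⟩ := hQ.exists_aut_extends hF hf le_sup_left
  obtain rfl := hα.target_eq_sup hfe
  exact ⟨f, hf, hfe⟩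

variable {p : ℕ} [Fact p.Prime] [Finite F.carrier]

theorem IsInvariant.extendsOver_of_fullyNormalized (hI : IsInvariant (inner Q) F)
    (hP : IsPGroup p F.carrier) (hF : F.IsSaturated p) {e : R ≃* T} (he : e ∈ F.Iso R T)
    (hT : F.FullyNormalized T)
    (ih : ∀ S ≤ F.carrier, Nat.card R < Nat.card S → ∀ U, ∀ f ∈ F.Iso S U, ExtendsOver F Q f) :
    ExtendsOver F Q e := by
  have hQ : F.StronglyClosed Q := hI.stronglyClosed
  by_cases hQR : Q ≤ R
  · exact hQ.extendsOver_of_extends hF.toIsFusionSystem he ⟨le_rfl, fun _ => rfl⟩ hQR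
  have hRP : R ≤ F.carrier := F.source_le he
  have hQRP : Q ⊔ R ≤ F.carrier := sup_le hQ.1 hRP
  have : Finite (Q ⊔ R : Subgroup G) := Finite.Set.subset F.carrier hQRP
  let N := R ⊔ Q ⊓ Subgroup.normalizer (R : Set G)
  have hRN : R < N := left_lt_sup.2 (not_inf_normalizer_le (hP.to_le hQRP)
    (hRP.trans (hQ.le_normalizer hF.toIsFusionSystem)) hQR)
  have hN : N ≤ extensionGroup F.carrier e.toMonoidHom :=
    sup_le (le_extensionGroup hRP _ ((image_toMonoidHom e).trans_le hT.1))
      (hI.inf_normalizer_le_extensionGroup hP hF he hT)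
  obtain ⟨U, f, hf, hfe⟩ := hF.exists_extension he hT hRN.le hN
  have hNP : N ≤ F.carrier := F.source_le hf
  have : Finite N := Finite.Set.subset F.carrier hNP
  have hcard : Nat.card R < Nat.card N :=
    lt_of_not_ge fun h => hRN.ne (Subgroup.eq_of_le_of_card_ge hRN.le h)
  obtain ⟨f', hf', hff'⟩ := ih N hNP hcard U f hf
  exact hQ.extendsOver_of_extends hF.toIsFusionSystem hf' (hff'.trans hfe) le_sup_left

theorem IsInvariant.extendsOver (hI : IsInvariant (inner Q) F) (hP : IsPGroup p F.carrier)
    (hF : F.IsSaturated p) {e : R ≃* T} (he : e ∈ F.Iso R T) : ExtendsOver F Q e := by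
  refine le_induction_of_card_lt
    (motive := fun R => ∀ T, ∀ e ∈ F.Iso R T, ExtendsOver F Q e)
    (fun R _ ih T e he => ?_) R (F.source_le he) T e he
  obtain ⟨M, hM, τ, hτ⟩ := hF.exists_fullyNormalized (F.target_le he)
  refine .of_trans hF.toIsFusionSystem (τ := τ)
    (hI.extendsOver_of_fullyNormalized hP hF (hF.comp_mem he hτ) hM ih)
    (hI.extendsOver_of_fullyNormalized hP hF hτ hM ?_)
  rwa [← Nat.card_congr e.toEquiv]

theorem eq_normalizer_of_isInvariant (hP : IsPGroup p F.carrier) (hF : F.IsSaturated p)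
    (hI : IsInvariant (inner Q) F) : F = F.normalizer Q := by
  have hFF : F.IsFusionSystem := hF.toIsFusionSystem
  have hQ : F.StronglyClosed Q := hI.stronglyClosed
  have hnorm : norm F.carrier Q = F.carrier := inf_eq_left.2 (hQ.le_normalizer hFF)
  refine PrefusionSystem.ext hnorm.symm ?_
  ext R S φ
  refine ⟨fun hφ => ?_, fun h => h.2.2.1⟩
  have hS : S ≤ F.carrier := F.target_le hφ
  obtain ⟨ψ, hψ, hψφ⟩ := hI.extendsOver hP hF (hFF.isoImage_mem hφ)
  obtain ⟨α, -, hψα⟩ := hQ.exists_aut_extends hFF hψ le_sup_left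
  have hle : Q ⊔ image φ ≤ Q ⊔ S := sup_le_sup_left (image_le φ) Q
  exact ⟨hnorm.symm ▸ F.source_le hφ, hnorm.symm ▸ hS, hφ,
    (Subgroup.inclusion hle).comp ψ.toMonoidHom,
    hFF.comp_mem hψ (hFF.inclusion_mem hle (sup_le hQ.1 hS)), hψφ, α, hψα⟩

end ExtendsOver

section Inner

theorem inner_isFusionSystem (Q : Subgroup G) : (inner Q).IsFusionSystem where
  comp_mem := by
    rintro R S T φ ψ ⟨hR, -, g, hg, hφ⟩ ⟨-, hT, h, hh, hψ⟩
    exact ⟨hR, hT, g * h, mul_mem hg hh, fun x => by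
      rw [MonoidHom.comp_apply, hψ, hφ]; group⟩
  conj_mem hR hS g hg _ hφ := ⟨hR, hS, g, hg, hφ⟩
  toImage_mem := fun {_ _ φ} ⟨hR, hS, g, hg, hφ⟩ => ⟨hR, (image_le φ).trans hS, g, hg, hφ⟩
  symm_mem := by
    rintro R S e ⟨hR, hS, g, hg, he⟩
    refine ⟨hS, hR, g⁻¹, inv_mem hg, fun y => ?_⟩
    obtain ⟨x, rfl⟩ := e.surjective y
    have hx : (e x : G) = g⁻¹ * x * g := he x
    change (e.symm (e x) : G) = _
    rw [hx, e.symm_apply_apply]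
    group

theorem inner_aut (Q : Subgroup G) :
    (inner_isFusionSystem Q).aut Q le_rfl = conjAut Q Q := by
  refine le_antisymm ?_ ((inner_isFusionSystem Q).conjAut_le_aut le_rfl)
  rintro α ⟨-, -, g, hg, hα⟩
  refine mem_conjAut.2 ⟨g⁻¹, inv_mem ⟨hg, Subgroup.le_normalizer hg⟩, fun x => ?_⟩
  rw [inv_inv]
  exact hα x

theorem inner_isSaturated {p : ℕ} (hQ : IsPGroup p Q) : (inner Q).IsSaturated p where
  toIsFusionSystem := inner_isFusionSystem Q
  sylow := by
    have hp : IsPGroup p (⊤ : Subgroup ((inner_isFusionSystem Q).aut Q le_rfl)) :=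
      IsPGroup.of_equiv (inner_aut Q ▸ conjAut_isPGroup hQ Q) Subgroup.topEquiv.symm
    refine ⟨⟨⊤, hp, fun _ h => top_le_iff.1 h⟩, ?_⟩
    exact (MonoidHom.range_eq_map _).symm.trans ((Subgroup.range_subtype _).trans (inner_aut Q))
  extension := by
    rintro R φ ⟨hR, -, g, hg, hφ⟩ -
    change ∃ ψ ∈ (inner Q).Hom (extensionGroup Q φ) Q, _
    have hN : extensionGroup Q φ ≤ Q := fun x hx => hx.1.1
    have hconj : ∀ x ∈ extensionGroup Q φ, g⁻¹ * x * g ∈ Q := fun x hx =>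
      mul_mem (mul_mem (inv_mem hg) (hN hx)) hg
    exact ⟨conjHom g hconj, ⟨hN, le_rfl, g, hg, conjHom_apply g hconj⟩,
      le_extensionGroup hR φ (image_le φ), fun x => (conjHom_apply g hconj _).trans (hφ x).symm⟩

end Inner

section Normalizer

theorem exists_extends_of_eq_normalizer (h : F = F.normalizer Q) {φ : R →* S}
    (hφ : φ ∈ F.Hom R S) : ∃ ψ ∈ F.Hom (Q ⊔ R) (Q ⊔ S),
      Extends ψ φ ∧ ∃ α : MulAut Q, Extends ψ α.toMonoidHom := by
  rw [h] at hφ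
  exact hφ.2.2.2

theorem exists_mulAut_of_eq_normalizer (h : F = F.normalizer Q) {φ : R →* S}
    (hφ : φ ∈ F.Hom R S) (hR : R ≤ Q) :
    ∃ α : MulAut Q, ∀ x : R, (φ x : G) = α (Subgroup.inclusion hR x) := by
  obtain ⟨ψ, -, hψφ, α, hψα⟩ := exists_extends_of_eq_normalizer h hφ
  exact ⟨α, fun x => (hψφ.2 x).symm.trans (hψα.2 (Subgroup.inclusion hR x))⟩

theorem stronglyClosed_of_eq_normalizer (hF : F.IsFusionSystem) (h : F = F.normalizer Q) :
    F.StronglyClosed Q := by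
  obtain ⟨ψ, hψ, -⟩ := exists_extends_of_eq_normalizer h (hF.refl_mem (bot_le (a := F.carrier)))
  refine ⟨le_sup_left.trans (F.source_le hψ), ?_⟩
  rintro R S hR φ hφ _ ⟨x, rfl⟩
  obtain ⟨α, hα⟩ := exists_mulAut_of_eq_normalizer h hφ hR
  exact Set.mem_of_eq_of_mem (hα x) (SetLike.coe_mem _)

theorem isInvariant_of_eq_normalizer (hF : F.IsFusionSystem) (h : F = F.normalizer Q) :
    IsInvariant (inner Q) F where
  isSubsystem := by
    have hQ := (stronglyClosed_of_eq_normalizer hF h).1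
    exact ⟨inner_isFusionSystem Q, hQ, fun R S φ ⟨hR, hS, g, hg, hφ⟩ =>
      hF.conj_mem (hR.trans hQ) (hS.trans hQ) g (hQ hg) φ hφ⟩
  stronglyClosed := stronglyClosed_of_eq_normalizer hF h
  conj_mem := by
    rintro R S hRS (hS : S ≤ Q) φ ⟨-, -, g, hg, hφ⟩ ψ hψ
    obtain ⟨α, hα⟩ := exists_mulAut_of_eq_normalizer h hψ hS
    have hle : image (ψ.comp (Subgroup.inclusion hRS)) ≤ Q :=
      (stronglyClosed_of_eq_normalizer hF h).2 R F.carrier (hRS.trans hS) _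
        (hF.comp_inclusion_mem hψ hRS)
    let k : Q := α ⟨g, hg⟩
    have hk : ∀ x ∈ image (ψ.comp (Subgroup.inclusion hRS)), (k : G)⁻¹ * x * k ∈ Q := fun x hx =>
      mul_mem (mul_mem (inv_mem k.2) (hle hx)) k.2
    refine ⟨conjHom k hk, ⟨hle, le_rfl, k, k.2, conjHom_apply _ hk⟩, fun r => ?_⟩
    have hαφ : α (Subgroup.inclusion hS (φ r)) =
        k⁻¹ * α (Subgroup.inclusion hS (Subgroup.inclusion hRS r)) * k := by
      rw [← map_inv, ← map_mul, ← map_mul]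
      exact congrArg α (Subtype.ext (hφ r))
    rw [hα (φ r), hαφ, Subgroup.coe_mul, Subgroup.coe_mul, Subgroup.coe_inv, ← hα]
    exact conjHom_apply _ hk _

end Normalizer

end PrefusionSystem

theorem theoremA_general {G : Type*} [Group G] (p : ℕ) [Fact p.Prime] (F : PrefusionSystem G)
    [Finite F.carrier] (hP : IsPGroup p F.carrier) (hF : F.IsSaturated p) (Q : Subgroup G) :
    F = F.normalizer Q ↔ PrefusionSystem.IsNormalSubsystem p (PrefusionSystem.inner Q) F := by
  constructor
  · intro h
    have hI := PrefusionSystem.isInvariant_of_eq_normalizer hF.toIsFusionSystem h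
    exact ⟨hI, PrefusionSystem.inner_isSaturated (hP.to_le hI.stronglyClosed.1)⟩
  · exact fun h => PrefusionSystem.eq_normalizer_of_isInvariant hP hF h.1

/-- A saturated fusion system `F` on a finite `p`-group `P` is equal to `N_F(Q)` if and only if
`F_Q(Q)` is a normal subsystem of `F`. -/
theorem theoremA (p : ℕ) [Fact p.Prime] {P : Type*} [Group P] [Finite P] (hP : IsPGroup p P)
    (F : PrefusionSystem P) (hFP : F.carrier = ⊤) (hF : F.IsSaturated p) (Q : Subgroup P) :
    F = F.normalizer Q ↔ PrefusionSystem.IsNormalSubsystem p (PrefusionSystem.inner Q) F :=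
  theoremA_general p F (hP.to_subgroup _) hF Q
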